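/- A Markov decision process (MDP) $\mathcal M$ consists of a finite set $S$ of states, a finite set $\mathit{Act}$ of actions, a nonempty set $\gamma(s)\subseteq \mathit{Act}$ of enabled actions for each $s\in S$, a set $\lambda(s)$ of atomic propositions for each $s\in S$, state rewards $\mathrm{rew}(s)\ge 0$, and transition probabilities $\delta(s,\alpha,t)\in[0,1]$ with $\sum_{t\in S}\delta(s,\alpha,t)=1$ for all $s\in S$, $\alpha\in\mathit{Act}$. A scheduler $\sigma$ maps each nonempty finite sequence $s_0\dots s_i$ of states to an action in $\gamma(s_i)$; for an initial state $s=s_0$ it induces the unique probability measure $\Pr_s^\sigma$ on $S^{\omega}$ with $\Pr_s^\sigma(s_0\dots s_j\cdot S^\omega)=\prod_{i<j}\delta(s_i,\sigma(s_0\dots s_i),s_{i+1})$. A path $s_0s_1\dots$ fulfils $a\,\mathsf U\,b$ if there is $j\in\mathbb N$ with $b\in\lambda(s_j)$ and $a\in\lambda(s_i)$ for all $i<j$; it fulfils $a\,\mathsf U_{\le r}\,b$ if such a $j$ exists with, in addition, $\sum_{i<j}\mathrm{rew}(s_i)\le r$. For ${\rhd}\in\{\ge,>\}$ and $p\in[0,1]$,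 the value of $s$ with respect to the query $\varphi=\exists\mathsf P_{\rhd p}(a\,\mathsf U_{\le ?}\,b)$ is $$\mathrm{val}_\varphi(s)=\inf\{r\in\mathbb R:\ \Pr_s^\sigma(a\,\mathsf U_{\le r}\,b)\rhd p\ \text{for some scheduler }\sigma\}\in\mathbb R\cup\{\pm\infty\},\qquad \inf\emptyset=\infty .$$ **Lemma.** Let $\mathcal M$ be an MDP whose state rewards are natural numbers and whose transition probabilities $\delta(s,\alpha,t)$, $\alpha\in\gamma(s)$, are rational numbers with denominator (in lowest terms) at most $m$. Let $a,b$ be atomic propositions, ${\rhd}\in\{\ge,>\}$, $p\in[0,1]$, $\varphi=\exists\mathsf P_{\rhd p}(a\,\mathsf U_{\le ?}\,b)$, $n=|\{t\in S: a\in\lambda(t)\}|$, $c=\max\{\mathrm{rew}(t): t\in S,\ a\in\lambda(t)\}$ (with $c=0$ if $n=0$), and $s\in S$. Then the maximum $q=\max_\sigma\Pr_s^\sigma(a\,\mathsf U\,b)$ over all schedulers $\sigma$ exists, and at least one of the following statements holds: 1. $p\ge q$ and $\mathrm{val}_\varphi(s)=\infty$; 2. $p=q$, ${\rhd}={\ge}$,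 and $\mathrm{val}_\varphi(s)\le nc$; 3. $p<q$ and $\mathrm{val}_\varphi(s)\le k\,n\,c\,m^n$, where $k=\max\{-\lfloor\ln(q-p)\rfloor,\,1\}$. -/

import Mathlib

open MeasureTheory ProbabilityTheory
open scoped NNReal ENNReal

/-- A Markov decision process with nonnegative state rewards: `enabled s` is the nonempty set of
actions enabled in `s`, `label s` the set of atomic propositions true in `s`, and `δ s α t` the
probability to move from `s` to `t` under the action `α`. -/
structure MDP (S Act AP : Type*) [Fintype S] where
  enabled : S → Set Act
  enabled_nonempty : ∀ s, (enabled s).Nonempty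
  label : S → Set AP
  rew : S → ℝ≥0
  δ : S → Act → S → ℝ
  δ_nonneg : ∀ s α t, 0 ≤ δ s α t
  δ_sum : ∀ s α, ∑ t, δ s α t = 1

namespace MDP

variable {S Act AP : Type*} [Fintype S]

/-- A (deterministic, history-dependent) scheduler: it maps every nonempty finite sequence
`s₀ s₁ … sₙ` of states to an action that is enabled in the last state `sₙ`. -/
structure Scheduler (M : MDP S Act AP) where
  act : (n : ℕ) → (Finset.Iic n → S) → Act
  act_mem : ∀ (n : ℕ) (h : Finset.Iic n → S),
    act n h ∈ M.enabled (h ⟨n, Finset.mem_Iic.2 le_rfl⟩)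

section PathMeasure

variable [MeasurableSpace S] [DiscreteMeasurableSpace S]

/-- The distribution of the successor of `s` under the action `α`. -/
noncomputable def stepMeasure (M : MDP S Act AP) (s : S) (α : Act) : Measure S :=
  ∑ t, ENNReal.ofReal (M.δ s α t) • Measure.dirac t

instance (M : MDP S Act AP) (s : S) (α : Act) : IsProbabilityMeasure (M.stepMeasure s α) := by
  refine ⟨?_⟩
  simp only [stepMeasure, Measure.coe_finsetSum, Finset.sum_apply, Measure.smul_apply,
    measure_univ, smul_eq_mul, mul_one]
  rw [← ENNReal.ofReal_sum_of_nonneg fun t _ => M.δ_nonneg s α t, M.δ_sum, ENNReal.ofReal_one]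

/-- The kernel giving the state at time `n + 1` from the states at the times `0, …, n`. -/
noncomputable def stepKernel (M : MDP S Act AP) (σ : M.Scheduler) (n : ℕ) :
    Kernel (Finset.Iic n → S) S :=
  Kernel.ofFunOfCountable fun h =>
    M.stepMeasure (h ⟨n, Finset.mem_Iic.2 le_rfl⟩) (σ.act n h)

instance (M : MDP S Act AP) (σ : M.Scheduler) (n : ℕ) : IsMarkovKernel (M.stepKernel σ n) :=
  ⟨fun h => inferInstanceAs
    (IsProbabilityMeasure (M.stepMeasure (h ⟨n, Finset.mem_Iic.2 le_rfl⟩) (σ.act n h)))⟩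

/-- The probability measure on the infinite state sequences that is induced by the scheduler `σ`
and the initial state `s` (obtained from the Ionescu-Tulcea theorem). -/
noncomputable def pathMeasure (M : MDP S Act AP) (σ : M.Scheduler) (s : S) : Measure (ℕ → S) :=
  Kernel.traj (X := fun _ => S) (M.stepKernel σ) 0 fun _ => s

instance (M : MDP S Act AP) (σ : M.Scheduler) (s : S) :
    IsProbabilityMeasure (M.pathMeasure σ s) := by
  unfold pathMeasure; infer_instance

/-- The characterising property of the path measure: the cylinder `s₀ s₁ … s_k · S^ω` with
`s₀ = s` has probability `∏_{i<k} δ(s_i, σ(s₀ … s_i), s_{i+1})`. -/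
theorem pathMeasure_cylinder (M : MDP S Act AP) (σ : M.Scheduler) (w : ℕ → S) (k : ℕ) :
    (M.pathMeasure σ (w 0)).real {π | ∀ i ≤ k, π i = w i} =
      ∏ i ∈ Finset.range k, M.δ (w i) (σ.act i fun j => w j) (w (i + 1)) := by
  have hx : ∀ n, {π : ℕ → S | ∀ i ≤ n, π i = w i} =
      Preorder.frestrictLe (π := fun _ => S) n ⁻¹' {fun j : Finset.Iic n => w j} := by
    intro n
    ext π
    simp only [Set.mem_ofPred_eq, Set.mem_preimage, Set.mem_singleton_iff, funext_iff,
      Subtype.forall, Finset.mem_Iic, Preorder.frestrictLe_apply]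
  induction k with
  | zero =>
    have h := Kernel.traj_map_frestrictLe_apply (X := fun _ => S) (κ := M.stepKernel σ) 0 0
      (fun _ => w 0)
    rw [Kernel.partialTraj_self, Kernel.id_apply] at h
    rw [hx, measureReal_def, ← Measure.map_apply (by fun_prop) (MeasurableSet.singleton _),
      pathMeasure, h, Measure.dirac_apply' _ (MeasurableSet.singleton _)]
    have : (fun _ : Finset.Iic 0 => w 0) = fun j : Finset.Iic 0 => w j := by
      funext j
      obtain ⟨j, hj⟩ := j
      have : j = 0 := by simpa using hj
      subst this
      rfl
    simp [this]
  | succ k ih =>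
    have h := Kernel.partialTraj_compProd_eq_map_traj (X := fun _ => S) (κ := M.stepKernel σ)
      (Nat.zero_le k) (x₀ := fun _ => w 0)
    rw [← Kernel.traj_map_frestrictLe_apply] at h
    have hset : {π : ℕ → S | ∀ i ≤ k + 1, π i = w i} =
        (fun x : ℕ → S => (Preorder.frestrictLe (π := fun _ => S) k x, x (k + 1))) ⁻¹'
          ({fun j : Finset.Iic k => w j} ×ˢ {w (k + 1)}) := by
      ext π
      simp only [Set.mem_ofPred_eq, Set.mem_preimage, Set.mem_prod, Set.mem_singleton_iff,
        funext_iff, Subtype.forall, Finset.mem_Iic, Preorder.frestrictLe_apply]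
      constructor
      · exact fun H => ⟨fun i hi => H i (by omega), H _ le_rfl⟩
      · rintro ⟨H1, H2⟩ i hi
        rcases Nat.lt_or_ge k i with h' | h'
        · obtain rfl : i = k + 1 := by omega
          exact H2
        · exact H1 i h'
    rw [hset, Finset.prod_range_succ, ← ih, hx, measureReal_def, measureReal_def,
      ← Measure.map_apply (by fun_prop)
        ((MeasurableSet.singleton _).prod (MeasurableSet.singleton _)), pathMeasure, ← h,
      Measure.compProd_apply_prod (MeasurableSet.singleton _) (MeasurableSet.singleton _),
      lintegral_singleton, ENNReal.toReal_mul, mul_comm,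
      Measure.map_apply (by fun_prop) (MeasurableSet.singleton _)]
    congr 1
    change (M.stepMeasure (w k) (σ.act k fun j => w j) {w (k + 1)}).toReal = _
    classical
    simp [stepMeasure, Set.indicator_apply, M.δ_nonneg]

end PathMeasure

/-- The paths that fulfil `a U b`. -/
def untilSet (M : MDP S Act AP) (a b : AP) : Set (ℕ → S) :=
  {π | ∃ k, b ∈ M.label (π k) ∧ ∀ i < k, a ∈ M.label (π i)}

/-- The paths that fulfil `a U_{≤ r} b`; the reward of a state is earned upon leaving it. -/
def untilLeSet (M : MDP S Act AP) (a b : AP) (r : ℝ) : Set (ℕ → S) :=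
  {π | ∃ k, b ∈ M.label (π k) ∧ (∀ i < k, a ∈ M.label (π i)) ∧
    ∑ i ∈ Finset.range k, (M.rew (π i) : ℝ) ≤ r}

/-- The comparison operators `≥` and `>`. -/
inductive LowerCmp
  | ge
  | gt

/-- `x ⊳ p` for `⊳` one of `≥` and `>`. -/
def LowerCmp.holds : LowerCmp → ℝ → ℝ → Prop
  | .ge, x, p => x ≥ p
  | .gt, x, p => x > p

/-- `s ⊨ ∃P_{⊳ p} (a U_{≤ r} b)`: the probability of `a U_{≤ r} b` from `s` is `⊳ p` under some
scheduler. -/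
def ExistsUntilLe [MeasurableSpace S] [DiscreteMeasurableSpace S] (M : MDP S Act AP)
    (cmp : LowerCmp) (p : ℝ) (a b : AP) (r : ℝ) (s : S) : Prop :=
  ∃ σ : M.Scheduler, cmp.holds ((M.pathMeasure σ s).real (M.untilLeSet a b r)) p

/-- The value of the state `s` with respect to the query `∃P_{⊳ p} (a U_{≤ ?} b)`: the infimum, in
the extended reals, of all real `r` with `s ⊨ ∃P_{⊳ p} (a U_{≤ r} b)` (so `⊤` if there is none). -/
noncomputable def existsUntilValue [MeasurableSpace S] [DiscreteMeasurableSpace S]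
    (M : MDP S Act AP) (cmp : LowerCmp) (p : ℝ) (a b : AP) (s : S) : EReal :=
  sInf ((fun r : ℝ => (r : EReal)) '' {r : ℝ | M.ExistsUntilLe cmp p a b r s})

/-- The set of states labelled with `a`. -/
def labelled (M : MDP S Act AP) (a : AP) : Set S :=
  {s | a ∈ M.label s}

/-- The largest reward of a state labelled with `a` (`0` if there is no such state). -/
noncomputable def maxRew (M : MDP S Act AP) (a : AP) : ℝ≥0 :=
  sSup (M.rew '' M.labelled a)

end MDP

/-!
After its first step, a scheduler behaves like another scheduler, so the probabilities of `a U b`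
and `a U_{≤ r} b` are averages over the first step, and they lie below every nonnegative function
that is at least `1` at the `b`-states and that no step through an `a`-state increases in
expectation.

Let `v` be the maximal probability of `a U b`, `n` the number of `a`-states and `c` their largest
reward. If `v` is positive at a state, then optimal actions lead from this state through `a`-states
to a `b`-state within `n` steps: otherwise scaling `v` down at the states without such a path would
still yield an upper bound. A memoryless policy that follows these paths thus retains at most the
fraction `1 - m⁻ⁿ` of its shortfall from `v` whenever its budget grows by `n c`, which gives the
existence of the maximum and, since `(1 - m⁻ⁿ) ^ (k mⁿ) < exp (-k)`, the bound for `p < q`.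

For the bound in the case `p = q`, let `B s` be the minimal budget that suffices for the probability
`v s`. An optimal scheduler passes only through optimal actions, so if `B s > 0`, then it pays for a
state only to reach states `t` with `B t < B s`; if all of these satisfied `B t < B s - c`, one
could start with less than `B s`. Hence consecutive values of `B` differ by at most `c`, and as `B`
vanishes at the states without `a`, it is at most `n c`.
-/

section Preliminaries

theorem measureReal_iUnion_le_of_monotone {α : Type*} [MeasurableSpace α] {μ : Measure α}
    [IsFiniteMeasure μ] {E : ℕ → Set α} (hE : Monotone E) {x : ℝ} (h : ∀ k, μ.real (E k) ≤ x) :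
    μ.real (⋃ k, E k) ≤ x :=
  le_of_tendsto' ((ENNReal.tendsto_toReal (measure_ne_top μ _)).comp
    (tendsto_measure_iUnion_atTop hE)) h

theorem exists_factor_lt_one {ι : Type*} [Finite ι] (f g : ι → ℝ) :
    ∃ l, 0 ≤ l ∧ l < 1 ∧ ∀ i, f i < g i → f i ≤ l * g i := by
  have hfg : ∀ᶠ l : ℝ in nhdsWithin 1 (Set.Iio 1), ∀ i, f i < g i → f i ≤ l * g i := by
    refine Filter.eventually_all.2 fun i => ?_
    by_cases hi : f i < g i
    · have hlim : Filter.Tendsto (· * g i) (nhdsWithin 1 (Set.Iio 1)) (nhds (g i)) := by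
        simpa using ((continuous_mul_const (g i)).tendsto 1).mono_left nhdsWithin_le_nhds
      exact (hlim.eventually_const_lt hi).mono fun l hl _ => hl.le
    · exact Filter.Eventually.of_forall fun l h => absurd h hi
  obtain ⟨l, ⟨hl, hl0⟩, hl1⟩ := ((hfg.and
    (Ioo_mem_nhdsLT zero_lt_one)).and self_mem_nhdsWithin).exists
  exact ⟨l, hl0.1.le, hl1, hl⟩

theorem le_card_mul_of_forall_exists_le_add {ι : Type*} {f : ι → ℝ} {c : ℝ} (hc : 0 ≤ c)
    (A : Finset ι) (h : ∀ i ∈ A, f i ≤ c ∨ ∃ j ∈ A, f j < f i ∧ f i ≤ f j + c) :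
    ∀ i ∈ A, f i ≤ A.card * c := by
  classical
  induction A using Finset.strongInduction with
  | H A ih =>
    intro i hi
    have hcard : (1 : ℝ) ≤ A.card := mod_cast Finset.card_pos.2 ⟨i, hi⟩
    obtain hfi | ⟨j, hj, hji, hij⟩ := h i hi
    · exact hfi.trans (le_mul_of_one_le_left hc hcard)
    · have hsub : A.filter (f · < f i) ⊂ A :=
        Finset.filter_ssubset.2 ⟨i, hi, lt_irrefl _⟩
      have hj' : f j ≤ (A.filter (f · < f i)).card * c := by
        refine ih _ hsub (fun x hx => ?_) j (Finset.mem_filter.2 ⟨hj, hji⟩)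
        obtain ⟨hxA, hxi⟩ := Finset.mem_filter.1 hx
        refine (h x hxA).imp_right fun ⟨y, hy, hyx, hxy⟩ => ?_
        exact ⟨y, Finset.mem_filter.2 ⟨hy, hyx.trans hxi⟩, hyx, hxy⟩
      have hlt : ((A.filter (f · < f i)).card : ℝ) + 1 ≤ A.card := mod_cast Finset.card_lt_card hsub
      nlinarith

theorem one_sub_inv_pow_lt_of_neg_le_log {d : ℝ} {x k : ℕ} (hx : 0 < x) (hk : 0 < k) (hd : 0 < d)
    (hkd : -(k : ℝ) ≤ Real.log d) : (1 - (x : ℝ)⁻¹) ^ (k * x) < d := by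
  have hx0 : (0 : ℝ) < x := mod_cast hx
  have hexp : 1 - (x : ℝ)⁻¹ < Real.exp (-(x : ℝ)⁻¹) := by
    linarith [Real.add_one_lt_exp (neg_ne_zero.2 (inv_ne_zero hx0.ne'))]
  have hnonneg : 0 ≤ 1 - (x : ℝ)⁻¹ := sub_nonneg.2 (inv_le_one_of_one_le₀ (mod_cast hx))
  calc (1 - (x : ℝ)⁻¹) ^ (k * x) < Real.exp (-(x : ℝ)⁻¹) ^ (k * x) :=
        pow_lt_pow_left₀ hexp hnonneg (Nat.mul_pos hk hx).ne'
    _ = Real.exp (-k) := by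
        rw [← Real.exp_nat_mul]
        congr 1
        push_cast
        field_simp
    _ ≤ d := (Real.le_log_iff_exp_le hd).1 hkd

theorem one_le_mul_ratCast_of_den_le {m : ℕ} {x : ℚ} (hx : x.den ≤ m) (hpos : 0 < (x : ℝ)) :
    1 ≤ m * (x : ℝ) := by
  have hnum : (1 : ℚ) ≤ x.num := mod_cast Rat.num_pos.2 (Rat.cast_pos.1 hpos)
  have hmul : (1 : ℚ) ≤ m * x :=
    calc (1 : ℚ) ≤ x.den * x := by rwa [Rat.den_mul_eq_num]
      _ ≤ m * x := by
        have := (Rat.cast_pos.1 hpos).le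
        gcongr
  exact_mod_cast hmul

theorem measurableSet_setOf_forall_le_eq {S : Type*} [MeasurableSpace S]
    [MeasurableSingletonClass S] (x : ℕ → S) (k : ℕ) :
    MeasurableSet {π : ℕ → S | ∀ i ≤ k, π i = x i} := by
  simp only [measurableSet_setOfPred]
  exact Measurable.forall fun i => Measurable.forall fun _ =>
    measurableSet_setOfPred.1 ((MeasurableSet.singleton (x i)).preimage (measurable_pi_apply i))

theorem measure_ext_of_forall_cylinder {S : Type*} [Countable S] [MeasurableSpace S]
    [MeasurableSingletonClass S] {P Q : Measure (ℕ → S)} [IsFiniteMeasure P]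
    (h : ∀ (x : ℕ → S) (k : ℕ), P {π | ∀ i ≤ k, π i = x i} = Q {π | ∀ i ≤ k, π i = x i}) :
    P = Q := by
  have hP : IsProjectiveLimit P fun I : Finset ℕ => P.map I.restrict := fun I => rfl
  refine hP.unique ((isProjectiveLimit_nat_iff (fun I J hJI => ?_) Q).2
    fun n => Measure.ext_of_singleton fun u => ?_)
  · rw [Measure.map_map (Finset.measurable_restrict₂ hJI) (Finset.measurable_restrict I)]
    rfl
  · change Q.map (Preorder.frestrictLe n) {u} = P.map (Preorder.frestrictLe n) {u}
    rw [Measure.map_apply (by fun_prop) (MeasurableSet.singleton _),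
      Measure.map_apply (by fun_prop) (MeasurableSet.singleton _)]
    let x : ℕ → S := fun i => u ⟨min i n, Finset.mem_Iic.2 (min_le_right _ _)⟩
    have hpre : Preorder.frestrictLe (π := fun _ => S) n ⁻¹' {u} = {π | ∀ i ≤ n, π i = x i} := by
      ext π
      simp only [Set.mem_preimage, Set.mem_singleton_iff, funext_iff, Subtype.forall,
        Finset.mem_Iic, Preorder.frestrictLe_apply, Set.mem_ofPred_eq, x]
      exact forall₂_congr fun i hi => by simp [hi]
    rw [hpre]
    exact (h x n).symm

end Preliminaries

namespace MDP

section Expect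

variable {S Act AP : Type*} [Fintype S] (M : MDP S Act AP)

/-- The expectation of `f` at the successor of `s` under the action `α`. -/
def expect (s : S) (α : Act) (f : S → ℝ) : ℝ := ∑ t, M.δ s α t * f t

variable {M} {s : S} {α : Act} {f g : S → ℝ}

theorem expect_mono (h : ∀ t, 0 < M.δ s α t → f t ≤ g t) : M.expect s α f ≤ M.expect s α g := by
  refine Finset.sum_le_sum fun t _ => ?_
  rcases (M.δ_nonneg s α t).eq_or_lt with h0 | h0
  · simp [← h0]
  · exact mul_le_mul_of_nonneg_left (h t h0) h0.le

theorem expect_const (x : ℝ) : M.expect s α (fun _ => x) = x := by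
  rw [expect, ← Finset.sum_mul, M.δ_sum, one_mul]

theorem expect_const_mul (x : ℝ) : M.expect s α (fun t => x * f t) = x * M.expect s α f := by
  simp only [expect, Finset.mul_sum, mul_left_comm]

theorem expect_sub : M.expect s α (fun t => f t - g t) = M.expect s α f - M.expect s α g := by
  simp only [expect, mul_sub, Finset.sum_sub_distrib]

theorem expect_le_of_forall_le {x : ℝ} (h : ∀ t, 0 < M.δ s α t → f t ≤ x) :
    M.expect s α f ≤ x :=
  (expect_mono h).trans_eq (expect_const x)

theorem eq_of_expect_le_expect (hfg : ∀ t, f t ≤ g t) (h : M.expect s α g ≤ M.expect s α f)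
    {t : S} (ht : 0 < M.δ s α t) : f t = g t := by
  have hmul : ∀ t ∈ Finset.univ, M.δ s α t * f t ≤ M.δ s α t * g t :=
    fun t _ => mul_le_mul_of_nonneg_left (hfg t) (M.δ_nonneg s α t)
  have heq := (Finset.sum_eq_sum_iff_of_le hmul).1 (le_antisymm (Finset.sum_le_sum hmul) h)
  exact mul_left_cancel₀ ht.ne' (heq t (Finset.mem_univ t))

theorem expect_le_sub_mul {x y : ℝ} {t : S} (hx : ∀ t, f t ≤ x) (ht : f t ≤ x - y) :
    M.expect s α f ≤ x - M.δ s α t * y := by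
  classical
  calc M.expect s α f ≤ M.expect s α (fun t' => x - if t' = t then y else 0) := by
        refine expect_mono fun t' _ => ?_
        split_ifs with h
        · exact h ▸ ht
        · simpa using hx t'
    _ = x - M.δ s α t * y := by
        rw [expect_sub, expect_const]
        simp [expect]

end Expect

section Cons

variable {S : Type*}

/-- The infinite sequence `π` preceded by `s`. -/
def consPath (s : S) (π : ℕ → S) : ℕ → S
  | 0 => s
  | i + 1 => π i

/-- The finite sequence `h` preceded by `s`. -/
def consHist (s : S) {n : ℕ} (h : Finset.Iic n → S) : Finset.Iic (n + 1) → S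
  | ⟨0, _⟩ => s
  | ⟨i + 1, hi⟩ => h ⟨i, Finset.mem_Iic.2 (Nat.le_of_succ_le_succ (Finset.mem_Iic.1 hi))⟩

theorem consPath_preimage_cylinder_succ (x : ℕ → S) (k : ℕ) :
    consPath (x 0) ⁻¹' {π | ∀ i ≤ k + 1, π i = x i} = {π | ∀ i ≤ k, π i = x (i + 1)} := by
  ext π
  constructor
  · exact fun h i hi => h (i + 1) (Nat.succ_le_succ hi)
  · rintro h (_ | i) hi
    · rfl
    · exact h i (Nat.le_of_succ_le_succ hi)

theorem measurable_consPath [MeasurableSpace S] (s : S) : Measurable (consPath s) :=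
  measurable_pi_iff.2 fun i => by
    cases i with
    | zero => exact measurable_const
    | succ i => exact measurable_pi_apply i

end Cons

section Tail

variable {S Act AP : Type*} [Fintype S] {M : MDP S Act AP}

/-- The behaviour of the scheduler `σ` after the first state `s` has been left. -/
def Scheduler.tail (σ : M.Scheduler) (s : S) : M.Scheduler where
  act n h := σ.act (n + 1) (consHist s h)
  act_mem n h := σ.act_mem (n + 1) (consHist s h)

variable [MeasurableSpace S] [DiscreteMeasurableSpace S]

theorem pathMeasure_cylinder_of_ne (σ : M.Scheduler) {s : S} {x : ℕ → S} (hx : x 0 ≠ s) (k : ℕ) :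
    M.pathMeasure σ s {π | ∀ i ≤ k, π i = x i} = 0 := by
  have hs : M.pathMeasure σ s {π | π 0 = s} = 1 := by
    rw [← ENNReal.toReal_eq_one_iff, ← measureReal_def]
    simpa using M.pathMeasure_cylinder σ (fun _ => s) 0
  have hm : MeasurableSet {π : ℕ → S | π 0 = s} :=
    (MeasurableSet.singleton s).preimage (measurable_pi_apply 0)
  exact measure_mono_null (t := {π | π 0 = s}ᶜ)
    (fun π hπ hπs => hx ((hπ 0 k.zero_le).symm.trans hπs)) ((prob_compl_eq_zero_iff hm).2 hs)

theorem pathMeasure_cylinder_succ (σ : M.Scheduler) (x : ℕ → S) (k : ℕ) :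
    M.pathMeasure σ (x 0) {π | ∀ i ≤ k + 1, π i = x i} =
      ENNReal.ofReal (M.δ (x 0) (σ.act 0 fun _ => x 0) (x 1)) *
        M.pathMeasure (σ.tail (x 0)) (x 1) {π | ∀ i ≤ k, π i = x (i + 1)} := by
  have hhist : ∀ i, (fun j : Finset.Iic (i + 1) => x j) =
      consHist (x 0) fun j : Finset.Iic i => x (j + 1) := by
    intro i
    funext ⟨j, _⟩
    cases j <;> rfl
  have hhist0 : (fun j : Finset.Iic 0 => x j) = fun _ => x 0 :=
    funext fun j => congrArg x (Nat.le_zero.1 (Finset.mem_Iic.1 j.2))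
  rw [← ofReal_measureReal, M.pathMeasure_cylinder, Finset.prod_range_succ', hhist0, mul_comm,
    ENNReal.ofReal_mul (M.δ_nonneg _ _ _), ← ofReal_measureReal,
    M.pathMeasure_cylinder (σ.tail (x 0)) (fun i => x (i + 1)) k]
  simp only [hhist, Scheduler.tail]

theorem pathMeasure_eq_sum (σ : M.Scheduler) (s : S) :
    M.pathMeasure σ s = ∑ t, ENNReal.ofReal (M.δ s (σ.act 0 fun _ => s) t) •
      (M.pathMeasure (σ.tail s) t).map (consPath s) := by
  refine measure_ext_of_forall_cylinder fun x k => ?_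
  simp only [Measure.coe_finsetSum, Finset.sum_apply, Measure.smul_apply, smul_eq_mul,
    Measure.map_apply (measurable_consPath s) (measurableSet_setOf_forall_le_eq x k)]
  rcases ne_or_eq (x 0) s with hx | rfl
  · have hpre : consPath s ⁻¹' {π | ∀ i ≤ k, π i = x i} = ∅ :=
      Set.eq_empty_of_forall_notMem fun π hπ => hx (hπ 0 k.zero_le).symm
    simp [hpre, pathMeasure_cylinder_of_ne σ hx]
  cases k with
  | zero =>
    have hpre : consPath (x 0) ⁻¹' {π | ∀ i ≤ 0, π i = x i} = Set.univ := by
      ext π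
      simp [consPath]
    rw [← ofReal_measureReal, M.pathMeasure_cylinder]
    simp only [hpre, measure_univ, mul_one, Finset.range_zero, Finset.prod_empty]
    rw [← ENNReal.ofReal_sum_of_nonneg fun t _ => M.δ_nonneg _ _ t, M.δ_sum]
  | succ k =>
    rw [consPath_preimage_cylinder_succ, pathMeasure_cylinder_succ,
      Finset.sum_eq_single_of_mem (x 1) (Finset.mem_univ _)]
    intro t _ ht
    rw [pathMeasure_cylinder_of_ne (x := fun i => x (i + 1)) _ ht.symm, mul_zero]

theorem pathMeasure_real_eq_expect (σ : M.Scheduler) (s : S) {E : Set (ℕ → S)}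
    (hE : MeasurableSet E) : (M.pathMeasure σ s).real E =
      M.expect s (σ.act 0 fun _ => s) fun t =>
        (M.pathMeasure (σ.tail s) t).real (consPath s ⁻¹' E) := by
  rw [measureReal_def, pathMeasure_eq_sum]
  simp only [Measure.coe_finsetSum, Finset.sum_apply, Measure.smul_apply, smul_eq_mul,
    Measure.map_apply (measurable_consPath s) hE]
  rw [ENNReal.toReal_sum fun t _ => ENNReal.mul_ne_top ENNReal.ofReal_ne_top (measure_ne_top _ _)]
  simp [expect, measureReal_def, M.δ_nonneg]

theorem pathMeasure_congr {σ τ : M.Scheduler} {s : S}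
    (h : ∀ n (x : Finset.Iic n → S), x ⟨0, Finset.mem_Iic.2 n.zero_le⟩ = s →
      σ.act n x = τ.act n x) :
    M.pathMeasure σ s = M.pathMeasure τ s := by
  refine measure_ext_of_forall_cylinder fun x k => ?_
  rcases ne_or_eq (x 0) s with hx | rfl
  · rw [pathMeasure_cylinder_of_ne σ hx, pathMeasure_cylinder_of_ne τ hx]
  · rw [← ofReal_measureReal, ← ofReal_measureReal, M.pathMeasure_cylinder,
      M.pathMeasure_cylinder]
    exact congrArg _ (Finset.prod_congr rfl fun i _ => by rw [h i (fun j => x j) rfl])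

end Tail

section Until

variable {S Act AP : Type*} [Fintype S] {M : MDP S Act AP} {a b : AP}

variable (M a b) in
/-- The paths that fulfil `a U_{≤ r} b` after at most `k` steps. -/
def untilLeWithin (k : ℕ) (r : ℝ) : Set (ℕ → S) :=
  {π | ∃ j ≤ k, b ∈ M.label (π j) ∧ (∀ i < j, a ∈ M.label (π i)) ∧
    ∑ i ∈ Finset.range j, (M.rew (π i) : ℝ) ≤ r}

theorem monotone_untilLeWithin (r : ℝ) : Monotone fun k => M.untilLeWithin a b k r :=
  fun _ _ hk _ ⟨j, hj, h⟩ => ⟨j, hj.trans hk, h⟩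

theorem untilLeSet_eq_iUnion (r : ℝ) : M.untilLeSet a b r = ⋃ k, M.untilLeWithin a b k r := by
  ext π
  simp only [Set.mem_iUnion]
  exact ⟨fun ⟨j, hj⟩ => ⟨j, j, le_rfl, hj⟩, fun ⟨_, j, _, hj⟩ => ⟨j, hj⟩⟩

theorem monotone_untilLeSet : Monotone fun r => M.untilLeSet a b r :=
  fun _ _ hr _ ⟨j, hb, ha, hj⟩ => ⟨j, hb, ha, hj.trans hr⟩

theorem untilLeSet_subset_untilSet (r : ℝ) : M.untilLeSet a b r ⊆ M.untilSet a b :=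
  fun _ ⟨j, hb, ha, _⟩ => ⟨j, hb, ha⟩

theorem untilSet_eq_iUnion : M.untilSet a b = ⋃ k : ℕ, M.untilLeSet a b k := by
  refine subset_antisymm (fun π ⟨j, hb, ha⟩ => ?_)
    (Set.iUnion_subset fun k => untilLeSet_subset_untilSet k)
  obtain ⟨n, hn⟩ := exists_nat_ge (∑ i ∈ Finset.range j, (M.rew (π i) : ℝ))
  exact Set.mem_iUnion.2 ⟨n, j, hb, ha, hn⟩

theorem untilLeSet_eq_empty_of_neg {r : ℝ} (hr : r < 0) : M.untilLeSet a b r = ∅ := by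
  refine Set.eq_empty_of_forall_notMem ?_
  rintro π ⟨j, _, _, hj⟩
  exact (hj.trans_lt hr).not_ge (Finset.sum_nonneg fun i _ => NNReal.coe_nonneg _)

theorem consPath_mem_untilLeWithin_zero {s : S} {π : ℕ → S} {r : ℝ} :
    consPath s π ∈ M.untilLeWithin a b 0 r ↔ b ∈ M.label s ∧ 0 ≤ r := by
  simp [untilLeWithin, consPath]

theorem consPath_mem_untilLeWithin_succ {s : S} {π : ℕ → S} {k : ℕ} {r : ℝ} :
    consPath s π ∈ M.untilLeWithin a b (k + 1) r ↔ (b ∈ M.label s ∧ 0 ≤ r) ∨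
      (a ∈ M.label s ∧ π ∈ M.untilLeWithin a b k (r - M.rew s)) := by
  have hsum (j : ℕ) : ∑ i ∈ Finset.range (j + 1), (M.rew (consPath s π i) : ℝ) ≤ r ↔
      ∑ i ∈ Finset.range j, (M.rew (π i) : ℝ) ≤ r - M.rew s := by
    rw [Finset.sum_range_succ', le_sub_iff_add_le]
    rfl
  constructor
  · rintro ⟨_ | j, hj, hb, ha, hr⟩
    · exact Or.inl ⟨hb, hr⟩
    · exact Or.inr ⟨ha 0 j.succ_pos, j, Nat.le_of_succ_le_succ hj, hb,
        fun i hi => ha (i + 1) (Nat.succ_lt_succ hi), (hsum j).1 hr⟩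
  · rintro (⟨hb, hr⟩ | ⟨ha, j, hj, hb, ha', hr⟩)
    · exact ⟨0, (k + 1).zero_le, hb, by simp, hr⟩
    · refine ⟨j + 1, Nat.succ_le_succ hj, hb, ?_, (hsum j).2 hr⟩
      rintro (_ | i) hi
      · exact ha
      · exact ha' i (Nat.lt_of_succ_lt_succ hi)

theorem consPath_mem_untilLeSet {s : S} {π : ℕ → S} {r : ℝ} :
    consPath s π ∈ M.untilLeSet a b r ↔ (b ∈ M.label s ∧ 0 ≤ r) ∨
      (a ∈ M.label s ∧ π ∈ M.untilLeSet a b (r - M.rew s)) := by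
  simp only [untilLeSet_eq_iUnion]
  rw [← (monotone_untilLeWithin r).iUnion_nat_add 1]
  simp only [Set.mem_iUnion, consPath_mem_untilLeWithin_succ, exists_or, exists_const,
    exists_and_left]

theorem consPath_mem_untilSet {s : S} {π : ℕ → S} :
    consPath s π ∈ M.untilSet a b ↔
      b ∈ M.label s ∨ (a ∈ M.label s ∧ π ∈ M.untilSet a b) := by
  constructor
  · rintro ⟨_ | j, hb, ha⟩
    · exact Or.inl hb
    · exact Or.inr ⟨ha 0 j.succ_pos, j, hb, fun i hi => ha (i + 1) (Nat.succ_lt_succ hi)⟩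
  · rintro (hb | ⟨ha, j, hb, ha'⟩)
    · exact ⟨0, hb, by simp⟩
    · refine ⟨j + 1, hb, ?_⟩
      rintro (_ | i) hi
      · exact ha
      · exact ha' i (Nat.lt_of_succ_lt_succ hi)

variable [MeasurableSpace S] [DiscreteMeasurableSpace S]

theorem measurableSet_untilLeWithin (k : ℕ) (r : ℝ) :
    MeasurableSet (M.untilLeWithin a b k r) := by
  have hlabel (x : AP) (i : ℕ) : Measurable fun π : ℕ → S => x ∈ M.label (π i) :=
    (measurable_of_countable fun t => x ∈ M.label t).comp (measurable_pi_apply i)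
  have hrew (i : ℕ) : Measurable fun π : ℕ → S => (M.rew (π i) : ℝ) :=
    (measurable_of_countable fun t => (M.rew t : ℝ)).comp (measurable_pi_apply i)
  refine measurableSet_setOfPred.2 (Measurable.exists fun j => measurable_const.and
    ((hlabel b j).and ((Measurable.forall fun i => measurable_const.imp (hlabel a i)).and ?_)))
  exact measurableSet_setOfPred.1
    (measurableSet_le (Finset.measurable_sum _ fun i _ => hrew i) measurable_const)

theorem measurableSet_untilLeSet (r : ℝ) : MeasurableSet (M.untilLeSet a b r) :=
  untilLeSet_eq_iUnion (M := M) r ▸ MeasurableSet.iUnion fun k => measurableSet_untilLeWithin k r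

theorem measurableSet_untilSet : MeasurableSet (M.untilSet a b) :=
  untilSet_eq_iUnion (M := M) ▸ MeasurableSet.iUnion fun _ => measurableSet_untilLeSet _

section Probability

variable (σ : M.Scheduler) {s : S} {r : ℝ}

theorem pathMeasure_untilLeSet_goal (hb : b ∈ M.label s) (hr : 0 ≤ r) :
    (M.pathMeasure σ s).real (M.untilLeSet a b r) = 1 := by
  rw [pathMeasure_real_eq_expect σ s (measurableSet_untilLeSet r)]
  simp [Set.preimage, consPath_mem_untilLeSet, hb, hr, expect_const]

theorem pathMeasure_untilLeSet_step (hb : b ∉ M.label s) (ha : a ∈ M.label s) :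
    (M.pathMeasure σ s).real (M.untilLeSet a b r) = M.expect s (σ.act 0 fun _ => s) fun t =>
      (M.pathMeasure (σ.tail s) t).real (M.untilLeSet a b (r - M.rew s)) := by
  rw [pathMeasure_real_eq_expect σ s (measurableSet_untilLeSet r)]
  simp [Set.preimage, consPath_mem_untilLeSet, hb, ha]

theorem pathMeasure_untilSet_goal (hb : b ∈ M.label s) :
    (M.pathMeasure σ s).real (M.untilSet a b) = 1 := by
  rw [pathMeasure_real_eq_expect σ s measurableSet_untilSet]
  simp [Set.preimage, consPath_mem_untilSet, hb, expect_const]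

theorem pathMeasure_untilSet_dead (hb : b ∉ M.label s) (ha : a ∉ M.label s) :
    (M.pathMeasure σ s).real (M.untilSet a b) = 0 := by
  rw [pathMeasure_real_eq_expect σ s measurableSet_untilSet]
  simp [Set.preimage, consPath_mem_untilSet, hb, ha, expect_const]

theorem pathMeasure_untilSet_step (hb : b ∉ M.label s) (ha : a ∈ M.label s) :
    (M.pathMeasure σ s).real (M.untilSet a b) = M.expect s (σ.act 0 fun _ => s) fun t =>
      (M.pathMeasure (σ.tail s) t).real (M.untilSet a b) := by
  rw [pathMeasure_real_eq_expect σ s measurableSet_untilSet]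
  simp [Set.preimage, consPath_mem_untilSet, hb, ha]

theorem pathMeasure_untilLeSet_mono {r' : ℝ} (hr : r ≤ r') :
    (M.pathMeasure σ s).real (M.untilLeSet a b r) ≤
      (M.pathMeasure σ s).real (M.untilLeSet a b r') :=
  measureReal_mono (monotone_untilLeSet hr)

end Probability

section Park

variable {F : M.Scheduler → S → ℝ → ℝ}

theorem pathMeasure_untilLeWithin_le (hF : ∀ σ t r, 0 ≤ F σ t r)
    (hgoal : ∀ σ t r, b ∈ M.label t → 0 ≤ r → 1 ≤ F σ t r)
    (hstep : ∀ (σ : M.Scheduler) t r, b ∉ M.label t → a ∈ M.label t →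
      M.expect t (σ.act 0 fun _ => t) (fun t' => F (σ.tail t) t' (r - M.rew t)) ≤ F σ t r)
    (k : ℕ) (σ : M.Scheduler) (s : S) (r : ℝ) :
    (M.pathMeasure σ s).real (M.untilLeWithin a b k r) ≤ F σ s r := by
  induction k generalizing σ s r with
  | zero =>
    by_cases hbr : b ∈ M.label s ∧ 0 ≤ r
    · exact measureReal_le_one.trans (hgoal σ s r hbr.1 hbr.2)
    · rw [pathMeasure_real_eq_expect σ s (measurableSet_untilLeWithin 0 r)]
      simpa [Set.preimage, consPath_mem_untilLeWithin_zero, hbr, expect_const] using hF σ s r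
  | succ k ih =>
    rcases lt_or_ge r 0 with hr | hr
    · have hempty : M.untilLeWithin a b (k + 1) r ⊆ ∅ :=
        (Set.subset_iUnion (M.untilLeWithin a b · r) (k + 1)).trans
          (untilLeSet_eq_iUnion (M := M) r ▸ (untilLeSet_eq_empty_of_neg hr).subset)
      simpa [Set.subset_empty_iff.1 hempty] using hF σ s r
    by_cases hb : b ∈ M.label s
    · exact measureReal_le_one.trans (hgoal σ s r hb hr)
    rw [pathMeasure_real_eq_expect σ s (measurableSet_untilLeWithin (k + 1) r)]
    by_cases ha : a ∈ M.label s
    · simp only [Set.preimage, consPath_mem_untilLeWithin_succ, hb, ha, false_and, true_and,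
        false_or]
      exact (expect_mono fun t _ => ih (σ.tail s) t (r - M.rew s)).trans (hstep σ s r hb ha)
    · simpa [Set.preimage, consPath_mem_untilLeWithin_succ, hb, ha, expect_const] using hF σ s r

theorem pathMeasure_untilLeSet_le (hF : ∀ σ t r, 0 ≤ F σ t r)
    (hgoal : ∀ σ t r, b ∈ M.label t → 0 ≤ r → 1 ≤ F σ t r)
    (hstep : ∀ (σ : M.Scheduler) t r, b ∉ M.label t → a ∈ M.label t →
      M.expect t (σ.act 0 fun _ => t) (fun t' => F (σ.tail t) t' (r - M.rew t)) ≤ F σ t r)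
    (σ : M.Scheduler) (s : S) (r : ℝ) :
    (M.pathMeasure σ s).real (M.untilLeSet a b r) ≤ F σ s r := by
  rw [untilLeSet_eq_iUnion]
  exact measureReal_iUnion_le_of_monotone (monotone_untilLeWithin r) fun k =>
    pathMeasure_untilLeWithin_le hF hgoal hstep k σ s r

theorem pathMeasure_untilSet_le {f : S → ℝ} (hf : ∀ t, 0 ≤ f t)
    (hgoal : ∀ t, b ∈ M.label t → 1 ≤ f t)
    (hstep : ∀ t, b ∉ M.label t → a ∈ M.label t → ∀ α ∈ M.enabled t, M.expect t α f ≤ f t)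
    (σ : M.Scheduler) (s : S) : (M.pathMeasure σ s).real (M.untilSet a b) ≤ f s := by
  rw [untilSet_eq_iUnion]
  exact measureReal_iUnion_le_of_monotone (monotone_untilLeSet.comp Nat.mono_cast) fun k =>
    pathMeasure_untilLeSet_le (F := fun _ t _ => f t) (fun _ t _ => hf t)
      (fun _ t _ hb _ => hgoal t hb) (fun σ t _ hb ha => hstep t hb ha _ (σ.act_mem 0 fun _ => t))
      σ s k

end Park

end Until

section Schedulers

variable {S Act AP : Type*} [Fintype S] {M : MDP S Act AP}

/-- The memoryless scheduler that always takes the action `μ t` in the state `t`. -/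
def stationary (μ : ∀ t, M.enabled t) : M.Scheduler where
  act n h := μ (h ⟨n, Finset.mem_Iic.2 le_rfl⟩)
  act_mem _ _ := (μ _).2

theorem tail_stationary (μ : ∀ t, M.enabled t) (s : S) :
    (stationary μ).tail s = stationary μ := rfl

instance : Nonempty M.Scheduler :=
  ⟨stationary fun t => ⟨_, (M.enabled_nonempty t).some_mem⟩⟩

theorem exists_scheduler_act_eq {s : S} {α : Act} (hα : α ∈ M.enabled s) :
    ∃ σ : M.Scheduler, σ.act 0 (fun _ => s) = α := by
  classical
  exact ⟨stationary (Function.update (fun t => ⟨_, (M.enabled_nonempty t).some_mem⟩) s ⟨α, hα⟩),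
    by simp [stationary]⟩

/-- The finite sequence `h` without its first state. -/
def tailHist {S : Type*} {n : ℕ} (h : Finset.Iic (n + 1) → S) : Finset.Iic n → S :=
  fun i => h ⟨i + 1, Finset.mem_Iic.2 (Nat.succ_le_succ (Finset.mem_Iic.1 i.2))⟩

open Classical in
/-- The actions of `Scheduler.switch`, by recursion on the length of the history. -/
noncomputable def Scheduler.switchAct (Z : Set S) (τ : S → S → M.Scheduler) :
    (n : ℕ) → M.Scheduler → (Finset.Iic n → S) → Act
  | 0, σ, h => σ.act 0 h
  | n + 1, σ, h =>
    let s := h ⟨0, Finset.mem_Iic.2 (Nat.zero_le _)⟩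
    if s ∈ Z then switchAct Z τ n (σ.tail s) (tailHist h)
    else (τ s (h ⟨1, Finset.mem_Iic.2 (Nat.succ_le_succ n.zero_le)⟩)).act n (tailHist h)

/-- The scheduler that follows `σ` until a state `s` outside of `Z` is left for a state `t`, and
from then on behaves like `τ s t` started in `t`. -/
noncomputable def Scheduler.switch (Z : Set S) (τ : S → S → M.Scheduler) (σ : M.Scheduler) :
    M.Scheduler where
  act n h := switchAct Z τ n σ h
  act_mem n h := by
    induction n generalizing σ with
    | zero => exact σ.act_mem 0 h
    | succ n ih =>
      simp only [switchAct]
      split_ifs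
      · exact ih _ (tailHist h)
      · exact (τ _ _).act_mem n (tailHist h)

variable {Z : Set S} {τ : S → S → M.Scheduler} {σ : M.Scheduler} {s : S}

theorem tail_switch_of_mem (hs : s ∈ Z) : (σ.switch Z τ).tail s = (σ.tail s).switch Z τ := by
  simp only [Scheduler.tail, Scheduler.switch, Scheduler.mk.injEq]
  funext n h
  exact if_pos hs

theorem pathMeasure_tail_switch_of_notMem [MeasurableSpace S] [DiscreteMeasurableSpace S]
    (hs : s ∉ Z) (t : S) :
    M.pathMeasure ((σ.switch Z τ).tail s) t = M.pathMeasure (τ s t) t :=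
  pathMeasure_congr fun _ _ ht => ht ▸ if_neg hs

end Schedulers

section MaxUntilProb

variable {S Act AP : Type*} [Fintype S] [MeasurableSpace S] [DiscreteMeasurableSpace S]

/-- The supremum, over all schedulers, of the probabilities of `a U b` from `s`. -/
noncomputable def maxUntilProb (M : MDP S Act AP) (a b : AP) (s : S) : ℝ :=
  ⨆ σ : M.Scheduler, (M.pathMeasure σ s).real (M.untilSet a b)

variable {M : MDP S Act AP} {a b : AP} {s : S}

theorem pathMeasure_untilSet_le_maxUntilProb (σ : M.Scheduler) (s : S) :
    (M.pathMeasure σ s).real (M.untilSet a b) ≤ M.maxUntilProb a b s :=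
  le_ciSup (f := fun σ : M.Scheduler => (M.pathMeasure σ s).real (M.untilSet a b))
    ⟨1, Set.forall_mem_range.2 fun _ => measureReal_le_one⟩ σ

theorem pathMeasure_untilLeSet_le_maxUntilProb (σ : M.Scheduler) (s : S) (r : ℝ) :
    (M.pathMeasure σ s).real (M.untilLeSet a b r) ≤ M.maxUntilProb a b s :=
  (measureReal_mono (untilLeSet_subset_untilSet r)).trans
    (pathMeasure_untilSet_le_maxUntilProb σ s)

theorem maxUntilProb_nonneg (s : S) : 0 ≤ M.maxUntilProb a b s :=
  Real.iSup_nonneg fun _ => measureReal_nonneg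

theorem maxUntilProb_le_one (s : S) : M.maxUntilProb a b s ≤ 1 :=
  ciSup_le fun _ => measureReal_le_one

theorem maxUntilProb_goal (hb : b ∈ M.label s) : M.maxUntilProb a b s = 1 := by
  simp only [maxUntilProb, pathMeasure_untilSet_goal _ hb, ciSup_const]

theorem maxUntilProb_dead (hb : b ∉ M.label s) (ha : a ∉ M.label s) :
    M.maxUntilProb a b s = 0 := by
  simp only [maxUntilProb, pathMeasure_untilSet_dead _ hb ha, ciSup_const]

theorem expect_maxUntilProb_le (ha : a ∈ M.label s) {α : Act} (hα : α ∈ M.enabled s) :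
    M.expect s α (M.maxUntilProb a b) ≤ M.maxUntilProb a b s := by
  by_cases hb : b ∈ M.label s
  · exact maxUntilProb_goal (a := a) hb ▸ expect_le_of_forall_le fun t _ => maxUntilProb_le_one t
  refine le_of_forall_pos_sub_le fun ε hε => ?_
  obtain ⟨σ, hσ⟩ := exists_scheduler_act_eq hα
  choose τ hτ using fun t => exists_lt_of_lt_ciSup (sub_lt_self (M.maxUntilProb a b t) hε)
  calc M.expect s α (M.maxUntilProb a b) - ε
      = M.expect s α fun t => M.maxUntilProb a b t - ε := by rw [expect_sub, expect_const]
    _ ≤ M.expect s α fun t => (M.pathMeasure (τ t) t).real (M.untilSet a b) :=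
        expect_mono fun t _ => (hτ t).le
    _ = (M.pathMeasure (σ.switch ∅ fun _ => τ) s).real (M.untilSet a b) := by
        rw [pathMeasure_untilSet_step _ hb ha]
        simp only [pathMeasure_tail_switch_of_notMem (Set.notMem_empty s), ← hσ]
        rfl
    _ ≤ M.maxUntilProb a b s := pathMeasure_untilSet_le_maxUntilProb _ s

theorem maxUntilProb_le_pathMeasure_tail {σ : M.Scheduler} {r : ℝ} (hb : b ∉ M.label s)
    (ha : a ∈ M.label s)
    (h : M.maxUntilProb a b s ≤ (M.pathMeasure σ s).real (M.untilLeSet a b r)) {t : S}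
    (ht : 0 < M.δ s (σ.act 0 fun _ => s) t) :
    M.maxUntilProb a b t ≤
      (M.pathMeasure (σ.tail s) t).real (M.untilLeSet a b (r - M.rew s)) := by
  refine (eq_of_expect_le_expect (fun t => pathMeasure_untilLeSet_le_maxUntilProb _ t _) ?_ ht).ge
  rw [← pathMeasure_untilLeSet_step σ hb ha]
  exact (expect_maxUntilProb_le ha (σ.act_mem 0 fun _ => s)).trans h

variable (M a b) in
/-- The enabled actions of `s` that preserve the maximal probability of `a U b`. -/
def IsOptimalAction (s : S) (α : Act) : Prop :=
  α ∈ M.enabled s ∧ M.maxUntilProb a b s ≤ M.expect s α (M.maxUntilProb a b)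

theorem exists_isOptimalAction [Finite Act] (hb : b ∉ M.label s) (ha : a ∈ M.label s) :
    ∃ α, M.IsOptimalAction a b s α := by
  obtain ⟨α, hα, hmax⟩ := (M.enabled s).exists_max_image
    (M.expect s · (M.maxUntilProb a b)) (Set.toFinite _) (M.enabled_nonempty s)
  refine ⟨α, hα, ciSup_le fun σ => ?_⟩
  rw [pathMeasure_untilSet_step σ hb ha]
  exact (expect_mono fun t _ => pathMeasure_untilSet_le_maxUntilProb _ t).trans
    (hmax _ (σ.act_mem 0 fun _ => s))

end MaxUntilProb

section OptReach

variable {S Act AP : Type*} [Fintype S] [MeasurableSpace S] [DiscreteMeasurableSpace S]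

/-- The states from which optimal actions through `a`-states can lead to a `b`-state within `j`
steps. -/
def optReach (M : MDP S Act AP) (a b : AP) : ℕ → Set S
  | 0 => M.labelled b
  | j + 1 => optReach M a b j ∪ {s | a ∈ M.label s ∧
      ∃ α, M.IsOptimalAction a b s α ∧ ∃ t ∈ optReach M a b j, 0 < M.δ s α t}

variable {M : MDP S Act AP} {a b : AP}

theorem monotone_optReach : Monotone (M.optReach a b) :=
  monotone_nat_of_le_succ fun _ => Set.subset_union_left

theorem optReach_subset (j : ℕ) : M.optReach a b j ⊆ M.labelled b ∪ M.labelled a := by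
  induction j with
  | zero => exact Set.subset_union_left
  | succ j ih => exact Set.union_subset ih fun s hs => Or.inr hs.1

theorem optReach_succ_ncard_labelled :
    M.optReach a b ((M.labelled a).ncard + 1) = M.optReach a b (M.labelled a).ncard := by
  set n := (M.labelled a).ncard
  let f (j : ℕ) : ℕ := (M.optReach a b j \ M.labelled b).ncard
  have hgoal (j : ℕ) : M.labelled b ⊆ M.optReach a b j := monotone_optReach j.zero_le
  have heq {i j : ℕ} (hij : i ≤ j) (h : f i = f j) : M.optReach a b i = M.optReach a b j := by
    rw [← Set.sdiff_union_of_subset (hgoal i), ← Set.sdiff_union_of_subset (hgoal j),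
      Set.eq_of_subset_of_ncard_le (Set.sdiff_subset_sdiff_left (monotone_optReach hij)) h.ge]
  have hstab : f (n + 1) = f n := by
    refine Nat.stabilises_of_monotone (fun i j hij => Set.ncard_le_ncard
      (Set.sdiff_subset_sdiff_left (monotone_optReach hij))) (fun j => Set.ncard_le_ncard ?_)
      (fun j hj => ?_) n.le_succ
    · exact Set.sdiff_subset_iff.2 (optReach_subset j)
    · have hnext : M.optReach a b (j + 2) = M.optReach a b (j + 1) := by
        rw [optReach, ← heq j.le_succ hj]
        exact (heq j.le_succ hj).symm
      simp only [f, hnext]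
  exact (heq n.le_succ hstab.symm).symm

theorem maxUntilProb_eq_zero_of_closed [Finite Act] {U : Set S} (hgoal : M.labelled b ⊆ U)
    (hU : ∀ s ∉ U, a ∈ M.label s → ∀ α, M.IsOptimalAction a b s α → ∀ t, 0 < M.δ s α t → t ∉ U)
    {s : S} (hs : s ∉ U) : M.maxUntilProb a b s = 0 := by
  classical
  set v := M.maxUntilProb a b
  have hv : ∀ t, 0 ≤ v t := maxUntilProb_nonneg
  obtain ⟨l, hl0, hl1, hl⟩ := exists_factor_lt_one (fun i : S × Act => M.expect i.1 i.2 v)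
    fun i => v i.1
  -- Damping `v` outside of `U` keeps every step condition: actions that are not optimal have some
  -- slack, and optimal ones stay outside of `U`.
  let f (t : S) : ℝ := if t ∈ U then v t else l * v t
  have hfv (t : S) : f t ≤ v t := by
    by_cases ht : t ∈ U
    · simp [f, ht]
    · simpa [f, ht] using mul_le_of_le_one_left (hv t) hl1.le
  have hf0 (t : S) : 0 ≤ f t := by
    by_cases ht : t ∈ U
    · simpa [f, ht] using hv t
    · simpa [f, ht] using mul_nonneg hl0 (hv t)
  have hstep (t : S) (ha : a ∈ M.label t) (α : Act) (hα : α ∈ M.enabled t) :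
      M.expect t α f ≤ f t := by
    have hle : M.expect t α v ≤ v t := expect_maxUntilProb_le ha hα
    by_cases ht : t ∈ U
    · simpa [f, ht] using (expect_mono fun t' _ => hfv t').trans hle
    simp only [f, if_neg ht]
    rcases lt_or_ge (M.expect t α v) (v t) with hlt | hopt
    · exact (expect_mono fun t' _ => hfv t').trans (hl (t, α) hlt)
    · calc M.expect t α f ≤ M.expect t α fun t' => l * v t' :=
            expect_mono fun t' ht' => (if_neg (hU t ht ha α ⟨hα, hopt⟩ t' ht')).le
        _ ≤ l * v t := by
            rw [expect_const_mul]
            exact mul_le_mul_of_nonneg_left hle hl0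
  have hvf : v s ≤ f s := ciSup_le fun σ => pathMeasure_untilSet_le hf0
    (fun t hb => by simp [f, hgoal hb, v, maxUntilProb_goal hb])
    (fun t _ => hstep t) σ s
  simp only [f, if_neg hs] at hvf
  nlinarith [hv s]

theorem maxUntilProb_eq_zero_of_notMem_optReach [Finite Act] {s : S}
    (hs : s ∉ M.optReach a b (M.labelled a).ncard) : M.maxUntilProb a b s = 0 := by
  refine maxUntilProb_eq_zero_of_closed (monotone_optReach (Nat.zero_le _))
    (fun s hs ha α hα t ht htU => hs ?_) hs
  rw [← optReach_succ_ncard_labelled]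
  exact Or.inr ⟨ha, α, hα, t, htU, ht⟩

variable (M a b) in
/-- A memoryless policy that takes optimal actions only and comes one step closer to the `b`-states
with positive probability wherever an optimal action can do so. -/
def IsProgressPolicy (μ : ∀ s, M.enabled s) : Prop :=
  ∀ s, b ∉ M.label s → a ∈ M.label s → M.IsOptimalAction a b s (μ s) ∧
    ∀ j, s ∈ M.optReach a b (j + 1) → s ∉ M.optReach a b j →
      ∃ t ∈ M.optReach a b j, 0 < M.δ s (μ s) t

variable (M a b) in
theorem exists_isProgressPolicy [Finite Act] : ∃ μ, M.IsProgressPolicy a b μ := by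
  suffices h : ∀ s, ∃ α : M.enabled s, b ∉ M.label s → a ∈ M.label s →
      M.IsOptimalAction a b s α ∧ ∀ j, s ∈ M.optReach a b (j + 1) → s ∉ M.optReach a b j →
        ∃ t ∈ M.optReach a b j, 0 < M.δ s α t by
    choose μ hμ using h
    exact ⟨μ, hμ⟩
  intro s
  by_cases hs : b ∉ M.label s ∧ a ∈ M.label s
  swap
  · exact ⟨⟨_, (M.enabled_nonempty s).some_mem⟩, fun hb ha => absurd ⟨hb, ha⟩ hs⟩
  by_cases hreach : ∃ j, s ∈ M.optReach a b (j + 1) ∧ s ∉ M.optReach a b j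
  · obtain ⟨j, hj, hnj⟩ := hreach
    obtain ⟨-, α, hα, t, ht, hpos⟩ := hj.resolve_left hnj
    refine ⟨⟨α, hα.1⟩, fun _ _ => ⟨hα, fun i hi hni => ?_⟩⟩
    obtain rfl : i = j := le_antisymm (not_lt.1 fun h => hni (monotone_optReach h hj))
      (not_lt.1 fun h => hnj (monotone_optReach h hi))
    exact ⟨t, ht, hpos⟩
  · obtain ⟨α, hα⟩ := exists_isOptimalAction hs.1 hs.2
    exact ⟨⟨α, hα.1⟩, fun _ _ => ⟨hα, fun j hj hnj => absurd ⟨j, hj, hnj⟩ hreach⟩⟩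

end OptReach

section Convergence

variable {S Act AP : Type*} [Fintype S] {M : MDP S Act AP} {a b : AP}

theorem rew_le_maxRew {s : S} (ha : a ∈ M.label s) : (M.rew s : ℝ) ≤ M.maxRew a :=
  NNReal.coe_le_coe.2 (le_csSup (Set.toFinite _).bddAbove ⟨s, ha, rfl⟩)

theorem exists_prob_pos (s : S) (α : Act) : ∃ t, 0 < M.δ s α t := by
  by_contra! h
  linarith [M.δ_sum s α, Finset.sum_nonpos fun t (_ : t ∈ Finset.univ) => h t]

theorem prob_le_one (s : S) (α : Act) (t : S) : M.δ s α t ≤ 1 :=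
  (Finset.single_le_sum (fun t _ => M.δ_nonneg s α t) (Finset.mem_univ t)).trans_eq (M.δ_sum s α)

variable (M) in
theorem exists_nat_forall_one_le_mul_prob [Finite Act] :
    ∃ m : ℕ, ∀ s, ∀ α ∈ M.enabled s, ∀ t, 0 < M.δ s α t → 1 ≤ m * M.δ s α t := by
  have h : ∀ᶠ m : ℕ in Filter.atTop, ∀ s α t, 0 < M.δ s α t → 1 ≤ m * M.δ s α t := by
    simp only [Filter.eventually_all]
    intro s α t hpos
    exact (tendsto_natCast_atTop_atTop.atTop_mul_const hpos).eventually_ge_atTop 1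
  exact h.exists.imp fun m hm s α _ t => hm s α t

theorem pos_of_forall_one_le_mul_prob {m : ℕ}
    (hm : ∀ s, ∀ α ∈ M.enabled s, ∀ t, 0 < M.δ s α t → 1 ≤ m * M.δ s α t) (s : S) : 0 < m := by
  obtain ⟨α, hα⟩ := M.enabled_nonempty s
  obtain ⟨t, ht⟩ := M.exists_prob_pos s α
  refine Nat.pos_of_ne_zero fun h0 => ?_
  have hle := hm s α hα t ht
  rw [h0, Nat.cast_zero, zero_mul] at hle
  exact hle.not_gt zero_lt_one

variable [MeasurableSpace S] [DiscreteMeasurableSpace S]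

variable (M a b) in
/-- The amount by which the probability of `a U_{≤ r} b` from `s` under the memoryless policy `μ`
falls short of the maximal probability of `a U b`. -/
noncomputable def loss (μ : ∀ s, M.enabled s) (s : S) (r : ℝ) : ℝ :=
  M.maxUntilProb a b s - (M.pathMeasure (stationary μ) s).real (M.untilLeSet a b r)

variable {μ : ∀ s, M.enabled s} {s : S} {r : ℝ}

theorem antitone_loss (s : S) : Antitone (M.loss a b μ s) := fun _ _ hr =>
  sub_le_sub_left (pathMeasure_untilLeSet_mono _ hr) _

theorem loss_le_expect_loss (hμ : M.IsProgressPolicy a b μ) (hb : b ∉ M.label s)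
    (ha : a ∈ M.label s) :
    M.loss a b μ s r ≤ M.expect s (μ s) fun t => M.loss a b μ t (r - M.rew s) := by
  simp only [loss]
  rw [expect_sub, pathMeasure_untilLeSet_step _ hb ha, tail_stationary]
  exact sub_le_sub_right (hμ s hb ha).1.2 _

theorem loss_le_of_mem_optReach (hμ : M.IsProgressPolicy a b μ) {ε B : ℝ} (hε0 : 0 ≤ ε)
    (hε : ∀ s, ∀ α ∈ M.enabled s, ∀ t, 0 < M.δ s α t → ε ≤ M.δ s α t) (hr : 0 ≤ r) (hB : 0 ≤ B)
    (hloss : ∀ s, M.loss a b μ s r ≤ B) {j : ℕ} (hs : s ∈ M.optReach a b j) :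
    M.loss a b μ s (r + j * M.maxRew a) ≤ B - ε ^ j * B := by
  have hε1 : ε ≤ 1 := by
    obtain ⟨t, ht⟩ := M.exists_prob_pos s (μ s)
    exact (hε s _ (μ s).2 t ht).trans (prob_le_one s _ t)
  induction j generalizing s with
  | zero =>
    have hb : b ∈ M.label s := hs
    simp [loss, maxUntilProb_goal hb, pathMeasure_untilLeSet_goal _ hb hr]
  | succ j ih =>
    by_cases hsj : s ∈ M.optReach a b j
    · calc M.loss a b μ s (r + (j + 1 : ℕ) * M.maxRew a)
          ≤ M.loss a b μ s (r + j * M.maxRew a) := antitone_loss s (by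
            push_cast
            linarith [(M.maxRew a).coe_nonneg])
        _ ≤ B - ε ^ j * B := ih hsj
        _ ≤ B - ε ^ (j + 1) * B := sub_le_sub_left
            (mul_le_mul_of_nonneg_right (pow_le_pow_of_le_one hε0 hε1 j.le_succ) hB) B
    have hb : b ∉ M.label s := fun hb => hsj (monotone_optReach j.zero_le hb)
    have ha : a ∈ M.label s := (optReach_subset _ hs).resolve_left hb
    obtain ⟨t, ht, hpos⟩ := (hμ s hb ha).2 j hs hsj
    have hrs : M.rew s ≤ (M.maxRew a : ℝ) := rew_le_maxRew ha
    calc M.loss a b μ s (r + (j + 1 : ℕ) * M.maxRew a)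
        ≤ M.expect s (μ s) fun t => M.loss a b μ t (r + (j + 1 : ℕ) * M.maxRew a - M.rew s) :=
          loss_le_expect_loss hμ hb ha
      _ ≤ B - M.δ s (μ s) t * (ε ^ j * B) := by
          have hjc : 0 ≤ j * (M.maxRew a : ℝ) := by positivity
          refine expect_le_sub_mul (fun t' => (antitone_loss t' ?_).trans (hloss t'))
            ((antitone_loss t ?_).trans (ih ht)) <;>
          · push_cast
            linarith
      _ ≤ B - ε ^ (j + 1) * B := by
          rw [pow_succ', mul_assoc]
          have := hε s _ (μ s).2 t hpos
          gcongr

theorem loss_le_one_sub_pow_pow [Finite Act] (hμ : M.IsProgressPolicy a b μ) {m : ℕ}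
    (hm : ∀ s, ∀ α ∈ M.enabled s, ∀ t, 0 < M.δ s α t → 1 ≤ m * M.δ s α t) (K : ℕ) (s : S) :
    M.loss a b μ s (K * ((M.labelled a).ncard * M.maxRew a)) ≤
      (1 - ((m ^ (M.labelled a).ncard : ℕ) : ℝ)⁻¹) ^ K := by
  set n := (M.labelled a).ncard
  have hm0 : 0 < m := pos_of_forall_one_le_mul_prob hm s
  have hinv : ((m ^ n : ℕ) : ℝ)⁻¹ = (m : ℝ)⁻¹ ^ n := by rw [Nat.cast_pow, inv_pow]
  have hB : (0 : ℝ) ≤ 1 - ((m ^ n : ℕ) : ℝ)⁻¹ :=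
    sub_nonneg.2 (inv_le_one_of_one_le₀ (mod_cast Nat.one_le_pow _ _ hm0))
  have hδ (s α) (hα : α ∈ M.enabled s) (t) (ht : 0 < M.δ s α t) : (m : ℝ)⁻¹ ≤ M.δ s α t :=
    (inv_le_iff_one_le_mul₀' (mod_cast hm0)).2 (hm s α hα t ht)
  induction K generalizing s with
  | zero =>
    rw [pow_zero]
    exact (sub_le_self _ measureReal_nonneg).trans (maxUntilProb_le_one s)
  | succ K ih =>
    by_cases hs : s ∈ M.optReach a b n
    · calc M.loss a b μ s ((K + 1 : ℕ) * (n * M.maxRew a))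
          = M.loss a b μ s (K * (n * M.maxRew a) + n * M.maxRew a) := by
            congr 1
            push_cast
            ring
        _ ≤ _ := loss_le_of_mem_optReach hμ (by positivity) hδ (by positivity) (pow_nonneg hB K)
            ih hs
        _ = (1 - ((m ^ n : ℕ) : ℝ)⁻¹) ^ (K + 1) := by
            rw [← hinv]
            ring
    · rw [loss, maxUntilProb_eq_zero_of_notMem_optReach hs, zero_sub]
      exact (neg_nonpos.2 measureReal_nonneg).trans (pow_nonneg hB _)

variable (M a b) in
theorem isGreatest_maxUntilProb [Finite Act] (s : S) :
    IsGreatest (Set.range fun σ : M.Scheduler => (M.pathMeasure σ s).real (M.untilSet a b))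
      (M.maxUntilProb a b s) := by
  obtain ⟨μ, hμ⟩ := exists_isProgressPolicy M a b
  obtain ⟨m, hm⟩ := M.exists_nat_forall_one_le_mul_prob
  have hm0 : 0 < m := pos_of_forall_one_le_mul_prob hm s
  refine ⟨⟨stationary μ, le_antisymm (pathMeasure_untilSet_le_maxUntilProb _ s) ?_⟩,
    Set.forall_mem_range.2 fun σ => pathMeasure_untilSet_le_maxUntilProb σ s⟩
  refine sub_nonpos.1 (ge_of_tendsto' (tendsto_pow_atTop_nhds_zero_of_lt_one ?_ ?_) fun K =>
    (sub_le_sub_left (measureReal_mono (untilLeSet_subset_untilSet _)) _).trans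
      (loss_le_one_sub_pow_pow hμ hm K s))
  · exact sub_nonneg.2 (inv_le_one_of_one_le₀ (mod_cast Nat.one_le_pow _ _ hm0))
  · exact sub_lt_self 1 (by positivity)

theorem exists_scheduler_lt_of_lt_maxUntilProb [Finite Act] {m : ℕ}
    (hm : ∀ s, ∀ α ∈ M.enabled s, ∀ t, 0 < M.δ s α t → 1 ≤ m * M.δ s α t) {p : ℝ}
    (hp : p < M.maxUntilProb a b s) {k : ℕ} (hk : 0 < k)
    (hkp : -(k : ℝ) ≤ Real.log (M.maxUntilProb a b s - p)) :
    ∃ σ : M.Scheduler, p < (M.pathMeasure σ s).real (M.untilLeSet a b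
      ((k * m ^ (M.labelled a).ncard : ℕ) * ((M.labelled a).ncard * M.maxRew a))) := by
  obtain ⟨μ, hμ⟩ := exists_isProgressPolicy M a b
  have hlt := (loss_le_one_sub_pow_pow hμ hm (k * m ^ (M.labelled a).ncard) s).trans_lt
    (one_sub_inv_pow_lt_of_neg_le_log (Nat.pow_pos (pos_of_forall_one_le_mul_prob hm s)) hk
      (sub_pos.2 hp) hkp)
  exact ⟨stationary μ, by rw [loss] at hlt; linarith⟩

end Convergence

section MinBudget

variable {S Act AP : Type*} [Fintype S] [MeasurableSpace S] [DiscreteMeasurableSpace S]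

/-- Some scheduler reaches the maximal probability of `a U b` from `s` with the budget `r`. -/
def AttainsMax (M : MDP S Act AP) (a b : AP) (s : S) (r : ℝ) : Prop :=
  M.ExistsUntilLe .ge (M.maxUntilProb a b s) a b r s

/-- The infimum of the nonnegative budgets that suffice for the maximal probability of `a U b` from
`s`; it is a junk value if no budget does. -/
noncomputable def minBudget (M : MDP S Act AP) (a b : AP) (s : S) : ℝ :=
  sInf {r | 0 ≤ r ∧ M.AttainsMax a b s r}

variable {M : MDP S Act AP} {a b : AP} {s : S} {r r' : ℝ}

theorem AttainsMax.mono (h : M.AttainsMax a b s r) (hr : r ≤ r') : M.AttainsMax a b s r' :=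
  h.imp fun σ hσ => le_trans hσ (pathMeasure_untilLeSet_mono σ hr)

theorem attainsMax_zero_of_notMem (ha : a ∉ M.label s) : M.AttainsMax a b s 0 := by
  refine (inferInstance : Nonempty M.Scheduler).elim fun σ => ⟨σ, ?_⟩
  by_cases hb : b ∈ M.label s
  · exact (maxUntilProb_le_one s).trans_eq (pathMeasure_untilLeSet_goal σ hb le_rfl).symm
  · exact (maxUntilProb_dead hb ha).trans_le measureReal_nonneg

theorem minBudget_le_max (h : M.AttainsMax a b s r) : M.minBudget a b s ≤ max r 0 :=
  csInf_le ⟨0, fun _ hr => hr.1⟩ ⟨le_max_right _ _, h.mono (le_max_left _ _)⟩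

theorem minBudget_nonneg (s : S) : 0 ≤ M.minBudget a b s := Real.sInf_nonneg fun _ hr => hr.1

theorem attainsMax_of_minBudget_lt (h : ∃ r, M.AttainsMax a b s r)
    (hr : M.minBudget a b s < r) : M.AttainsMax a b s r := by
  obtain ⟨r₀, h₀⟩ := h
  have hne : {r | 0 ≤ r ∧ M.AttainsMax a b s r}.Nonempty :=
    ⟨max r₀ 0, le_max_right _ _, h₀.mono (le_max_left _ _)⟩
  obtain ⟨r₁, h₁, hlt⟩ := exists_lt_of_csInf_lt hne hr
  exact h₁.2.mono hlt.le

theorem pathMeasure_switch_untilLeSet_step (σ : M.Scheduler) (τ : S → S → M.Scheduler)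
    (hb : b ∉ M.label s) (ha : a ∈ M.label s) :
    (M.pathMeasure (σ.switch {x | M.rew x = 0} τ) s).real (M.untilLeSet a b r) =
      M.expect s (σ.act 0 fun _ => s) fun t =>
        if M.rew s = 0 then
          (M.pathMeasure ((σ.tail s).switch {x | M.rew x = 0} τ) t).real (M.untilLeSet a b r)
        else (M.pathMeasure (τ s t) t).real (M.untilLeSet a b (r - M.rew s)) := by
  rw [pathMeasure_untilLeSet_step _ hb ha]
  by_cases hs : M.rew s = 0
  · simp only [tail_switch_of_mem (Z := {x | M.rew x = 0}) hs, hs, NNReal.coe_zero, sub_zero,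
      if_true]
    rfl
  · simp only [pathMeasure_tail_switch_of_notMem (Z := {x | M.rew x = 0}) hs, if_neg hs]
    rfl

theorem maxUntilProb_le_pathMeasure_switch {τ : S → S → M.Scheduler} (hr' : 0 ≤ r')
    (hτ : ∀ x t, a ∈ M.label x → 0 < M.rew x → M.AttainsMax a b t (r - M.rew x) →
      M.maxUntilProb a b t ≤ (M.pathMeasure (τ x t) t).real (M.untilLeSet a b (r' - M.rew x)))
    {σ : M.Scheduler}
    (hσ : M.maxUntilProb a b s ≤ (M.pathMeasure σ s).real (M.untilLeSet a b r)) :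
    M.maxUntilProb a b s ≤
      (M.pathMeasure (σ.switch {x | M.rew x = 0} τ) s).real (M.untilLeSet a b r') := by
  classical
  -- In `F`, `ρ = r` says that no budget has been spent yet. Wherever `F` is not the probability to
  -- be bounded, it is the maximal one, which no action increases in expectation.
  let G (σ : M.Scheduler) (t : S) : ℝ :=
    (M.pathMeasure (σ.switch {x | M.rew x = 0} τ) t).real (M.untilLeSet a b r')
  let F (σ : M.Scheduler) (t : S) (ρ : ℝ) : ℝ :=
    if ρ = r ∧ M.maxUntilProb a b t ≤ (M.pathMeasure σ t).real (M.untilLeSet a b ρ)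
    then G σ t else M.maxUntilProb a b t
  have hF (σ t ρ) : F σ t ρ ≤ M.maxUntilProb a b t :=
    (ite_le_sup _ _ _).trans (sup_le (pathMeasure_untilLeSet_le_maxUntilProb _ t r') le_rfl)
  suffices h : (M.pathMeasure σ s).real (M.untilLeSet a b r) ≤ F σ s r by
    simpa only [F, hσ, and_self, if_true] using hσ.trans h
  refine pathMeasure_untilLeSet_le (fun σ t ρ => ?_) (fun σ t ρ hb _ => ?_)
    (fun σ t ρ hb ha => ?_) σ s r
  · exact (le_inf measureReal_nonneg (maxUntilProb_nonneg t)).trans (inf_le_ite _ _ _)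
  · exact (le_inf (pathMeasure_untilLeSet_goal _ hb hr').ge (maxUntilProb_goal hb).ge).trans
      (inf_le_ite _ _ _)
  · by_cases hopt : ρ = r ∧ M.maxUntilProb a b t ≤ (M.pathMeasure σ t).real (M.untilLeSet a b ρ)
    · simp only [F, G, if_pos hopt, pathMeasure_switch_untilLeSet_step σ τ hb ha]
      obtain ⟨rfl, hopt⟩ := hopt
      refine expect_mono fun t' ht' => ?_
      have hopt' := maxUntilProb_le_pathMeasure_tail hb ha hopt ht'
      by_cases ht : M.rew t = 0
      · simp only [ht, NNReal.coe_zero, sub_zero, true_and, if_true] at hopt' ⊢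
        exact (if_pos hopt').le
      · rw [if_neg ht]
        exact (hF _ t' _).trans (hτ t t' ha (pos_iff_ne_zero.2 ht) ⟨σ.tail t, hopt'⟩)
    · simp only [F, if_neg hopt]
      exact (expect_mono fun t' _ => hF _ t' _).trans
        (expect_maxUntilProb_le ha (σ.act_mem 0 fun _ => t))

theorem AttainsMax.of_transfer (hr' : 0 ≤ r') (h : M.AttainsMax a b s r)
    (htransfer : ∀ x t, a ∈ M.label x → 0 < M.rew x →
      M.AttainsMax a b t (r - M.rew x) → M.AttainsMax a b t (r' - M.rew x)) :
    M.AttainsMax a b s r' := by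
  have hτ (x t : S) : ∃ τ : M.Scheduler, M.AttainsMax a b t (r' - M.rew x) →
      M.maxUntilProb a b t ≤ (M.pathMeasure τ t).real (M.untilLeSet a b (r' - M.rew x)) := by
    by_cases hx : M.AttainsMax a b t (r' - M.rew x)
    · exact hx.imp fun τ hτ _ => hτ
    · exact ⟨Classical.arbitrary _, fun hx' => absurd hx' hx⟩
  choose τ hτ using hτ
  obtain ⟨σ, hσ⟩ := h
  exact ⟨σ.switch {x | M.rew x = 0} τ, maxUntilProb_le_pathMeasure_switch hr'
    (fun x t ha hx ht => hτ x t (htransfer x t ha hx ht)) hσ⟩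

theorem exists_minBudget_gap_le (hs : ∃ r, M.AttainsMax a b s r) (hpos : 0 < M.minBudget a b s) :
    ∃ t, (∃ r, M.AttainsMax a b t r) ∧ M.minBudget a b t < M.minBudget a b s ∧
      M.minBudget a b s ≤ M.minBudget a b t + M.maxRew a := by
  by_contra! hgap
  -- Without such a `t`, the maximum is attained with a budget `r'` slightly below `B`: once an
  -- optimal scheduler with a budget `r` slightly above `B` has paid for a state, it is in a state
  -- `t` with a minimal budget below `B`, hence below `B - maxRew a`.
  set B := M.minBudget a b s
  have hr : ∀ᶠ r in nhdsWithin B (Set.Ioi B), ∀ x, 0 < M.rew x → r - M.rew x < B := by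
    simp only [Filter.eventually_all]
    intro x hx
    have : B < B + M.rew x := lt_add_of_pos_right B hx
    filter_upwards [Ioo_mem_nhdsGT this] with r hr
    exact sub_lt_iff_lt_add.2 hr.2
  have hr' : ∀ᶠ r' in nhdsWithin B (Set.Iio B),
      ∀ t, M.minBudget a b t + M.maxRew a < B → M.minBudget a b t + M.maxRew a < r' := by
    simp only [Filter.eventually_all]
    intro t ht
    filter_upwards [Ioo_mem_nhdsLT ht] with r' hr'
    exact hr'.1
  obtain ⟨r, hr, hBr⟩ := (hr.and self_mem_nhdsWithin).exists
  obtain ⟨r', hr', h0r', hr'B⟩ := (hr'.and (Ioo_mem_nhdsLT hpos)).exists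
  refine hr'B.not_ge ?_
  rw [← max_eq_left h0r'.le]
  refine minBudget_le_max ((attainsMax_of_minBudget_lt hs hBr).of_transfer h0r'.le ?_)
  intro x t ha hx ht
  have hlt : M.minBudget a b t < B := (minBudget_le_max ht).trans_lt (max_lt (hr x hx) hpos)
  refine attainsMax_of_minBudget_lt ⟨_, ht⟩ ?_
  linarith [hr' t (hgap t ⟨_, ht⟩ hlt), rew_le_maxRew ha]

theorem minBudget_le (ha : a ∈ M.label s) (hs : ∃ r, M.AttainsMax a b s r) :
    M.minBudget a b s ≤ (M.labelled a).ncard * M.maxRew a := by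
  classical
  have hc : (0 : ℝ) ≤ M.maxRew a := NNReal.coe_nonneg _
  let A : Finset S := {t | a ∈ M.label t ∧ ∃ r, M.AttainsMax a b t r}
  have hA : A.card ≤ (M.labelled a).ncard := by
    rw [← Set.ncard_coe_finset]
    exact Set.ncard_le_ncard fun t ht => (Finset.mem_filter.1 ht).2.1
  have hchain := le_card_mul_of_forall_exists_le_add (f := M.minBudget a b) hc A fun t ht => ?_
  · refine (hchain s (by simp [A, ha, hs])).trans ?_
    gcongr
  rcases (minBudget_nonneg t).eq_or_lt with h0 | hpos
  · exact Or.inl (h0 ▸ hc)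
  obtain ⟨t', ht', hlt, hle⟩ := exists_minBudget_gap_le (Finset.mem_filter.1 ht).2.2 hpos
  by_cases ha' : a ∈ M.label t'
  · exact Or.inr ⟨t', by simp [A, ha', ht'], hlt, hle⟩
  · have h0 : M.minBudget a b t' ≤ max 0 0 := minBudget_le_max (attainsMax_zero_of_notMem ha')
    rw [max_self] at h0
    exact Or.inl (by linarith)

theorem AttainsMax.of_ncard_mul_maxRew_lt (hs : M.AttainsMax a b s r)
    (hr' : (M.labelled a).ncard * M.maxRew a < r') : M.AttainsMax a b s r' := by
  by_cases ha : a ∈ M.label s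
  · exact attainsMax_of_minBudget_lt ⟨r, hs⟩ ((minBudget_le ha ⟨r, hs⟩).trans_lt hr')
  · exact (attainsMax_zero_of_notMem ha).mono (le_trans (by positivity) hr'.le)

end MinBudget

section Value

variable {S Act AP : Type*} [Fintype S] [MeasurableSpace S] [DiscreteMeasurableSpace S]
variable {M : MDP S Act AP} {cmp : LowerCmp} {a b : AP} {s : S} {p r : ℝ}

theorem LowerCmp.holds_of_gt {x : ℝ} (h : p < x) : cmp.holds x p := by
  cases cmp
  exacts [h.le, h]

theorem existsUntilValue_le (h : M.ExistsUntilLe cmp p a b r s) :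
    M.existsUntilValue cmp p a b s ≤ (r : EReal) :=
  sInf_le ⟨r, h, rfl⟩

theorem existsUntilValue_eq_top (h : ∀ r, ¬M.ExistsUntilLe cmp p a b r s) :
    M.existsUntilValue cmp p a b s = ⊤ := by
  have hempty : {r : ℝ | M.ExistsUntilLe cmp p a b r s} = ∅ := Set.eq_empty_of_forall_notMem h
  rw [existsUntilValue, hempty, Set.image_empty, sInf_empty]

theorem AttainsMax.existsUntilValue_le (h : M.AttainsMax a b s r) :
    M.existsUntilValue .ge (M.maxUntilProb a b s) a b s ≤
      (((M.labelled a).ncard * M.maxRew a : ℝ) : EReal) :=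
  EReal.le_of_forall_lt_iff_le.1 fun _ hr =>
    MDP.existsUntilValue_le (h.of_ncard_mul_maxRew_lt (EReal.coe_lt_coe_iff.1 hr))

theorem ExistsUntilLe.eq_ge_and_attainsMax (h : M.ExistsUntilLe cmp p a b r s)
    (hp : M.maxUntilProb a b s ≤ p) :
    p = M.maxUntilProb a b s ∧ cmp = .ge ∧ M.AttainsMax a b s r := by
  obtain ⟨σ, hσ⟩ := h
  have hle := pathMeasure_untilLeSet_le_maxUntilProb (a := a) (b := b) σ s r
  cases cmp with
  | gt => exact absurd (hle.trans hp) (not_le.2 hσ)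
  | ge =>
    obtain rfl : p = M.maxUntilProb a b s := le_antisymm (le_trans hσ hle) hp
    exact ⟨rfl, rfl, σ, hσ⟩

theorem existsUntilValue_le_of_lt_maxUntilProb [Finite Act] {m : ℕ}
    (hm : ∀ s, ∀ α ∈ M.enabled s, ∀ t, 0 < M.δ s α t → 1 ≤ m * M.δ s α t)
    (hp : p < M.maxUntilProb a b s) :
    M.existsUntilValue cmp p a b s ≤
      (((max (-⌊Real.log (M.maxUntilProb a b s - p)⌋) 1 : ℤ) * (M.labelled a).ncard *
        M.maxRew a * m ^ (M.labelled a).ncard : ℝ) : EReal) := by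
  obtain ⟨k, hk⟩ := Int.eq_ofNat_of_zero_le
    (zero_le_one.trans (le_max_right (-⌊Real.log (M.maxUntilProb a b s - p)⌋) 1))
  have hk_log : -(k : ℝ) ≤ Real.log (M.maxUntilProb a b s - p) := by
    have hfloor : -(k : ℤ) ≤ ⌊Real.log (M.maxUntilProb a b s - p)⌋ := by lia
    exact_mod_cast Int.le_floor.1 hfloor
  obtain ⟨σ, hσ⟩ := exists_scheduler_lt_of_lt_maxUntilProb hm hp (by lia) hk_log
  refine (existsUntilValue_le ⟨σ, LowerCmp.holds_of_gt hσ⟩).trans_eq (congrArg _ ?_)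
  rw [hk]
  push_cast
  ring

end Value

end MDP

theorem mainTheorem5_general {S Act AP : Type*} [Fintype S] [Finite Act]
    [MeasurableSpace S] [DiscreteMeasurableSpace S] (M : MDP S Act AP) (m : ℕ)
    (hm : ∀ s, ∀ α ∈ M.enabled s, ∀ t, 0 < M.δ s α t → 1 ≤ m * M.δ s α t)
    (cmp : MDP.LowerCmp) (p : ℝ) (a b : AP) (s : S) (n : ℕ) (hn : n = (M.labelled a).ncard)
    (c : ℝ) (hc : c = M.maxRew a) :
    ∃ q : ℝ,
      IsGreatest (Set.range fun σ : M.Scheduler => (M.pathMeasure σ s).real (M.untilSet a b)) q ∧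
      ((p ≥ q ∧ M.existsUntilValue cmp p a b s = ⊤) ∨
        (p = q ∧ cmp = .ge ∧ M.existsUntilValue cmp p a b s ≤ ((n * c : ℝ) : EReal)) ∨
        (p < q ∧ M.existsUntilValue cmp p a b s ≤
          (((max (-⌊Real.log (q - p)⌋) 1 : ℤ) * n * c * m ^ n : ℝ) : EReal))) := by
  subst hn hc
  refine ⟨M.maxUntilProb a b s, MDP.isGreatest_maxUntilProb M a b s, ?_⟩
  rcases lt_or_ge p (M.maxUntilProb a b s) with hlt | hge
  · exact Or.inr (Or.inr ⟨hlt, MDP.existsUntilValue_le_of_lt_maxUntilProb hm hlt⟩)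
  by_cases hex : ∃ r, M.ExistsUntilLe cmp p a b r s
  · obtain ⟨r, hr⟩ := hex
    obtain ⟨rfl, rfl, hattains⟩ := hr.eq_ge_and_attainsMax hge
    exact Or.inr (Or.inl ⟨rfl, rfl, hattains.existsUntilValue_le⟩)
  · exact Or.inl ⟨hge, MDP.existsUntilValue_eq_top (not_exists.1 hex)⟩

theorem mainTheorem5 {S Act AP : Type*} [Fintype S] [Finite Act]
    [MeasurableSpace S] [DiscreteMeasurableSpace S]
    (M : MDP S Act AP)
    (hrew : ∀ s, ∃ j : ℕ, M.rew s = j)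
    (m : ℕ)
    (hm : ∀ s, ∀ α ∈ M.enabled s, ∀ t, ∃ x : ℚ, M.δ s α t = x ∧ x.den ≤ m)
    (cmp : MDP.LowerCmp) (p : ℝ) (hp0 : 0 ≤ p) (hp1 : p ≤ 1)
    (a b : AP) (s : S) (n : ℕ) (hn : n = (M.labelled a).ncard)
    (c : ℝ) (hc : c = M.maxRew a) :
    ∃ q : ℝ,
      IsGreatest (Set.range fun σ : M.Scheduler => (M.pathMeasure σ s).real (M.untilSet a b)) q ∧
      ((p ≥ q ∧ M.existsUntilValue cmp p a b s = ⊤) ∨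
        (p = q ∧ cmp = .ge ∧ M.existsUntilValue cmp p a b s ≤ ((n * c : ℝ) : EReal)) ∨
        (p < q ∧ M.existsUntilValue cmp p a b s ≤
          (((max (-⌊Real.log (q - p)⌋) 1 : ℤ) * n * c * m ^ n : ℝ) : EReal))) := by
  refine mainTheorem5_general M m (fun t α hα t' hpos => ?_) cmp p a b s n hn c hc
  obtain ⟨x, hx, hxm⟩ := hm t α hα t'
  exact hx ▸ one_le_mul_ratCast_of_den_le hxm (hx ▸ hpos)
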